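/- Let $X$ be a real Banach space. For nonnegative integers $k_1,\dots,k_n$ with sum $m$, let $\mathbb{R}(k_1,\dots,k_n;X)$ be the infimum of all $M>0$ such that $$\sup_{\|x_1\|\le 1,\dots,\|x_n\|\le 1}\bigl|L(\underbrace{x_1,\dots,x_1}_{k_1},\dots,\underbrace{x_n,\dots,x_n}_{k_n})\bigr|\le M\sup_{\|x\|\le 1}|L(x,\dots,x)|$$ for every continuous symmetric $m$-linear form $L:X^m\to\mathbb{R}$. Then for every fixed integer $n\ge 1$, $$\limsup_{m\to\infty}\ \max_{k_1+\cdots+k_n=m}\ \mathbb{R}(k_1,\dots,k_n;X)^{1/m}\le 2,$$ where the maximum is over all $n$-tuples of nonnegative integers with sum $m$. In particular, $\limsup_{m\to\infty}\mathbb{R}(k_1^{(m)},\dots,k_n^{(m)};X)^{1/m}\le 2$ for every choice, for each $m$, of such a tuple $(k_1^{(m)},\dots,k_n^{(m)})$ with sum $m$. -/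

import Mathlib

open Filter
open scoped ENNReal

namespace PolarizationConstant

/-- A continuous `m`-linear form is symmetric if it is invariant under all permutations of its
arguments. -/
def IsSymmForm {𝕜 X : Type*} [RCLike 𝕜] [NormedAddCommGroup X] [NormedSpace 𝕜 X] {m : ℕ}
    (L : ContinuousMultilinearMap 𝕜 (fun _ : Fin m => X) 𝕜) : Prop :=
  ∀ (σ : Equiv.Perm (Fin m)) (v : Fin m → X), L (fun j => v (σ j)) = L v

/-- The norm `sup_{‖x‖ ≤ 1} |L(x, …, x)|` of the homogeneous polynomial associated with `L`. The
supremum is over a nonempty bounded set of real numbers, since `L` is continuous. -/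
noncomputable def diagNorm {𝕜 X : Type*} [RCLike 𝕜] [NormedAddCommGroup X] [NormedSpace 𝕜 X]
    {m : ℕ} (L : ContinuousMultilinearMap 𝕜 (fun _ : Fin m => X) 𝕜) : ℝ :=
  ⨆ x : Metric.closedBall (0 : X) 1, ‖L (fun _ => (x : X))‖

/-- The `m`-tuple `(x₁, …, x₁, x₂, …, x₂, …, xₙ, …, xₙ)`, with `m = k₁ + ⋯ + kₙ`, in which `xᵢ`
occupies the `i`-th block, of length `kᵢ`. -/
def blockTuple {X : Type*} {n : ℕ} (k : Fin n → ℕ) (x : Fin n → X) : Fin (∑ i, k i) → X :=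
  fun j => x (finSigmaFinEquiv.symm j).1

/-- The supremum of `|L(x₁^{k₁} ⋯ xₙ^{kₙ})|` over `x₁, …, xₙ` in the closed unit ball. The supremum
is over a nonempty bounded set of real numbers, since `L` is continuous. -/
noncomputable def blockNorm {𝕜 X : Type*} [RCLike 𝕜] [NormedAddCommGroup X] [NormedSpace 𝕜 X]
    {n : ℕ} (k : Fin n → ℕ)
    (L : ContinuousMultilinearMap 𝕜 (fun _ : Fin (∑ i, k i) => X) 𝕜) : ℝ :=
  ⨆ x : Fin n → Metric.closedBall (0 : X) 1, ‖L (blockTuple k (fun i => (x i : X)))‖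

/-- The polarization constant `𝕜(k₁, …, kₙ; X)`: the infimum of all real `M > 0` such that
`sup |L(x₁^{k₁} ⋯ xₙ^{kₙ})| ≤ M sup |L(x, …, x)|` for all continuous symmetric `m`-linear forms `L`
on `X`, where `m = k₁ + ⋯ + kₙ`. The infimum is taken in `[0, ∞]`, so that it would be `∞` if there
were no such `M`. -/
noncomputable def polarizationConst (𝕜 : Type*) [RCLike 𝕜] {n : ℕ} (k : Fin n → ℕ) (X : Type*)
    [NormedAddCommGroup X] [NormedSpace 𝕜 X] : ℝ≥0∞ :=
  ⨅ M ∈ {M : ℝ | 0 < M ∧ ∀ L : ContinuousMultilinearMap 𝕜 (fun _ : Fin (∑ i, k i) => X) 𝕜,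
    IsSymmForm L → blockNorm k L ≤ M * diagNorm L}, ENNReal.ofReal M

end PolarizationConstant

namespace PolarizationConstant

/-! A mixed value of `L` is a coefficient of the polynomial `L (∑ j, (r j * t j) • x j, …)` in `t ∈
[-1, 1]^n`, where `r ≥ 0` and `∑ r ≤ 1` keep the argument in the unit ball. It is extracted by a
product of one-variable functionals of norm at most `1`, each killing powers below `k j` and sending
the `k j`-th to `2⁻¹ ^ k j` (`exists_chebyshev_functional`). Higher powers need not be killed: the
total degree is `m`, so any other monomial has some exponent below `k j`. This costs `2 ^ m` divided
by the multinomial probability of `k` with parameters `r` (`norm_map_comp_le`). For `r j = k j / m`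
that probability is at least `(e (m + 1)) ^ (-n)`, whose `m`-th root tends to `1`. -/

/-- A finitely supported functional of norm at most `1` on functions on `[-1, 1]` which kills
`t ^ l` for `l < k` and sends `t ^ k` to `2⁻¹ ^ k`. -/
theorem exists_chebyshev_functional (k : ℕ) : ∃ (N : ℕ) (t w : Fin N → ℝ), (∀ s, |t s| ≤ 1) ∧ ∑ s, |w s| ≤ 1 ∧
    (∀ l < k, ∑ s, w s * t s ^ l = 0) ∧ ∑ s, w s * t s ^ k = (2⁻¹ : ℝ) ^ k := by
  -- Nodes `cos (2πs/N)`, weights `cos (2πks/N) / N`: a discrete Chebyshev coefficient. The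
  -- frequencies below lie in `[0, 2k]`, so `2k + 1` nodes avoid aliasing.
  set N := 2 * k + 1 with hN
  have hN0 : N ≠ 0 := by omega
  have hNR : (N : ℝ) ≠ 0 := by exact_mod_cast hN0
  obtain ⟨ζ, hζ⟩ : ∃ ζ : ℂ, IsPrimitiveRoot ζ N := ⟨_, Complex.isPrimitiveRoot_exp N hN0⟩
  have hn : ‖ζ‖ = 1 := hζ.norm'_eq_one hN0
  have hns : ∀ a : ℕ, ‖ζ ^ a‖ = 1 := fun a => by rw [norm_pow, hn, one_pow]
  have hsum : ∀ a : ℕ, a < N → ∑ s : Fin N, (ζ ^ (s : ℕ)) ^ a = if a = 0 then (N : ℂ) else 0 := by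
    intro a ha
    split_ifs with h
    · simp [h]
    · have h1 : ζ ^ a ≠ 1 := hζ.pow_ne_one_of_pos_of_lt h ha
      have h2 : ∑ s : Fin N, (ζ ^ (s : ℕ)) ^ a = ∑ s ∈ Finset.range N, (ζ ^ a) ^ s := by
        rw [Finset.sum_range]
        exact Finset.sum_congr rfl fun s _ => by rw [← pow_mul, ← pow_mul, mul_comm]
      rw [h2, geom_sum_eq h1, ← pow_mul, mul_comm, pow_mul, hζ.pow_eq_one]
      simp
  have hcos : ∀ z : ℂ, ‖z‖ = 1 → z * (z.re : ℂ) = 2⁻¹ * (z ^ 2 + 1) := by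
    intro z hz
    have h1 : z * (starRingEnd ℂ) z = 1 := by rw [Complex.mul_conj, Complex.normSq_eq_norm_sq, hz]; simp
    have h2 : (z.re : ℂ) = (z + (starRingEnd ℂ) z) / 2 := by rw [Complex.add_conj]; simp
    rw [h2]
    linear_combination h1 / 2
  have key : ∀ l ≤ k, ∑ s : Fin N, (((ζ ^ (s : ℕ)) ^ k).re / N) * (ζ ^ (s : ℕ)).re ^ l =
      if l = k then (2⁻¹ : ℝ) ^ k else 0 := by
    intro l hl
    have h1 : ∀ z : ℂ, ‖z‖ = 1 → z ^ k * (z.re : ℂ) ^ l =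
        ∑ i ∈ Finset.range (l + 1), (2⁻¹ : ℂ) ^ l * (l.choose i : ℂ) * z ^ (2 * i + (k - l)) := by
      intro z hz
      obtain ⟨d, rfl⟩ := Nat.exists_eq_add_of_le hl
      rw [Nat.add_sub_cancel_left, pow_add, mul_right_comm, ← mul_pow, hcos z hz, mul_pow, add_pow,
        Finset.mul_sum, Finset.sum_mul]
      refine Finset.sum_congr rfl fun i _ => ?_
      rw [one_pow, pow_add, pow_mul]
      ring
    have h2 : ∑ s : Fin N, (ζ ^ (s : ℕ)) ^ k * ((ζ ^ (s : ℕ)).re : ℂ) ^ l =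
        if l = k then (2⁻¹ : ℂ) ^ k * N else 0 := by
      rw [Finset.sum_congr rfl fun (s : Fin N) _ => h1 _ (hns s), Finset.sum_comm]
      simp_rw [← Finset.mul_sum]
      -- The exponent `2 * i + (k - l)` vanishes only for `i = 0` and `l = k`.
      rw [Finset.sum_eq_single_of_mem 0 (by simp)]
      · rw [hsum _ (by omega)]
        rcases eq_or_ne l k with rfl | h
        · simp
        · rw [if_neg (by omega), if_neg h, mul_zero]
      · intro i hi h0
        have := Finset.mem_range.1 hi
        rw [hsum _ (by omega), if_neg (by omega), mul_zero]
    have h3 := congrArg Complex.re h2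
    rw [Complex.re_sum] at h3
    have h4 : ∀ s : Fin N, ((ζ ^ (s : ℕ)) ^ k * ((ζ ^ (s : ℕ)).re : ℂ) ^ l).re =
        ((ζ ^ (s : ℕ)) ^ k).re * (ζ ^ (s : ℕ)).re ^ l := fun s => by
      rw [← Complex.ofReal_pow, Complex.re_mul_ofReal]
    rw [Finset.sum_congr rfl fun s _ => h4 s] at h3
    have h5 : (if l = k then (2⁻¹ : ℂ) ^ k * N else 0).re = (if l = k then (2⁻¹ : ℝ) ^ k else 0) * N := by
      split_ifs
      · have : ((2⁻¹ : ℂ) ^ k * N) = (((2⁻¹ : ℝ) ^ k * N : ℝ) : ℂ) := by push_cast; rfl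
        rw [this, Complex.ofReal_re]
      · simp
    rw [h5] at h3
    refine mul_right_cancel₀ hNR ?_
    rw [← h3, Finset.sum_mul]
    exact Finset.sum_congr rfl fun s _ => by field_simp
  refine ⟨N, fun s => (ζ ^ (s : ℕ)).re, fun s => ((ζ ^ (s : ℕ)) ^ k).re / N, fun s => ?_, ?_, ?_, ?_⟩
  · exact (Complex.abs_re_le_norm _).trans (hns s).le
  · calc ∑ s : Fin N, |((ζ ^ (s : ℕ)) ^ k).re / N| ≤ ∑ s : Fin N, (1 / N : ℝ) := by
          refine Finset.sum_le_sum fun s _ => ?_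
          rw [abs_div, Nat.abs_cast]
          gcongr
          exact (Complex.abs_re_le_norm _).trans (by rw [norm_pow, hns, one_pow])
      _ ≤ 1 := by simp [hNR]
  · intro l hl
    rw [key l hl.le, if_neg hl.ne]
  · rw [key k le_rfl, if_pos rfl]

/-! ### Factorial and root asymptotics -/

theorem factorial_le_exp_mul_pow (k : ℕ) :
    (k.factorial : ℝ) ≤ Real.exp 1 * (k + 1) * (k ^ k * Real.exp (-k)) := by
  rcases Nat.eq_zero_or_pos k with rfl | hk
  · simp
  have main : (k.factorial : ℝ) ≤ Real.exp 1 * k * (k ^ k * Real.exp (-k)) := by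
    induction k, hk using Nat.le_induction with
    | base => simp [← Real.exp_add]
    | succ k hk ih =>
      have hk0 : (0 : ℝ) < k := by exact_mod_cast hk
      -- This is `e ≤ (1 + 1/k) ^ (k + 1)`, from `log y ≥ 1 - 1/y`.
      have h1 : Real.exp 1 * (k : ℝ) ^ (k + 1) ≤ (k + 1 : ℝ) ^ (k + 1) := by
        have h2 := Real.one_sub_inv_le_log_of_pos (x := (k + 1) / k) (by positivity)
        have h3 : 1 ≤ (k + 1 : ℝ) * Real.log ((k + 1) / k) := by
          calc (1 : ℝ) = (k + 1 : ℝ) * (1 - ((k + 1 : ℝ) / k)⁻¹) := by field_simp; ring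
            _ ≤ _ := by gcongr
        have h4 : Real.exp 1 ≤ ((k + 1 : ℝ) / k) ^ (k + 1) := by
          calc Real.exp 1 ≤ Real.exp ((k + 1 : ℝ) * Real.log ((k + 1) / k)) := Real.exp_le_exp.2 h3
            _ = _ := by
              rw [← Nat.cast_succ, Real.exp_nat_mul, Real.exp_log (by positivity)]
        rwa [div_pow, le_div_iff₀ (by positivity)] at h4
      rw [Nat.factorial_succ]
      push_cast
      calc ((k : ℝ) + 1) * k.factorial
          ≤ (k + 1) * (Real.exp 1 * k * (k ^ k * Real.exp (-k))) := by gcongr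
        _ = (k + 1) * Real.exp (-k) * (Real.exp 1 * k ^ (k + 1)) := by ring
        _ ≤ (k + 1) * Real.exp (-k) * (k + 1) ^ (k + 1) := by gcongr
        _ = _ := by
          rw [neg_add, Real.exp_add, Real.exp_neg 1]
          field_simp
  refine main.trans ?_
  gcongr
  linarith

theorem tendsto_two_pow_mul_rpow_one_div (n : ℕ) : Tendsto (fun m : ℕ =>
    ENNReal.ofReal (2 ^ m * (Real.exp 1 * (m + 1)) ^ n) ^ (1 / (m : ℝ))) atTop (nhds 2) := by
  have h : Tendsto (fun m : ℕ => 2 * Real.exp (n / m) * (((m : ℝ) + 1) ^ (1 / (m : ℝ))) ^ n)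
      atTop (nhds 2) := by
    have h1 : Tendsto (fun m : ℕ => Real.exp ((n : ℝ) / m)) atTop (nhds 1) := by
      rw [← Real.exp_zero]
      exact (Real.continuous_exp.tendsto 0).comp (tendsto_const_div_atTop_nhds_zero_nat _)
    have h2 : Tendsto (fun m : ℕ => ((m : ℝ) + 1) ^ (1 / (m : ℝ))) atTop (nhds 1) := by
      have := ((tendsto_rpow_div_mul_add 1 1 (-1) (by norm_num)).comp
        (tendsto_natCast_atTop_atTop (R := ℝ))).comp (tendsto_add_atTop_nat 1)
      refine this.congr fun m => ?_
      simp
    simpa using (h1.const_mul 2).mul (h2.pow n)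
  have h' := ENNReal.tendsto_ofReal h
  rw [show ENNReal.ofReal 2 = 2 by simp] at h'
  refine h'.congr' ?_
  filter_upwards [eventually_gt_atTop 0] with m hm
  have hm' : (m : ℝ) ≠ 0 := by positivity
  rw [ENNReal.ofReal_rpow_of_nonneg (by positivity) (by positivity)]
  congr 1
  rw [Real.mul_rpow (by positivity) (by positivity), ← Real.rpow_natCast 2 m,
    ← Real.rpow_mul (by positivity), mul_one_div_cancel hm', Real.rpow_one, mul_pow,
    Real.mul_rpow (by positivity) (by positivity), ← Real.exp_nat_mul, ← Real.exp_mul,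
    ← Real.rpow_natCast, ← Real.rpow_natCast, ← Real.rpow_mul (by positivity),
    ← Real.rpow_mul (by positivity)]
  ring_nf

/-! ### Counting words with prescribed letter multiplicities -/

theorem exists_perm_of_card_fiber {n m : ℕ} {f g : Fin m → Fin n}
    (h : ∀ j, ({i | f i = j} : Finset (Fin m)).card = ({i | g i = j} : Finset (Fin m)).card) :
    ∃ σ : Equiv.Perm (Fin m), g ∘ σ = f := by
  have e : ∀ j, {i // f i = j} ≃ {i // g i = j} := fun j =>
    Fintype.equivOfCardEq (by rw [Fintype.card_subtype, Fintype.card_subtype, h])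
  exact ⟨Equiv.ofFiberEquiv e, funext fun i => Equiv.ofFiberEquiv_map e i⟩

/-- Orbit counting: each fibre of `σ ↦ g ∘ σ` is a coset of the stabilizer of `g`, which has order
`∏ j, (k j)!`. -/
theorem factorial_le_card_fiber_mul {n m : ℕ} (g : Fin m → Fin n) (k : Fin n → ℕ)
    (hk : ∀ j, ({i | g i = j} : Finset (Fin m)).card = k j) :
    m.factorial ≤ (∏ j, (k j).factorial) *
      ({f | ∀ j, ({i | f i = j} : Finset (Fin m)).card = k j} : Finset (Fin m → Fin n)).card := by
  classical
  have h1 := Finset.card_le_mul_card_image (f := fun σ : Equiv.Perm (Fin m) => g ∘ σ)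
    Finset.univ (∏ j, (k j).factorial) (by
      intro a ha
      obtain ⟨τ, -, rfl⟩ := Finset.mem_image.1 ha
      have h2 := DomMulAct.stabilizer_card g
      simp only [Fintype.card_subtype, hk] at h2
      rw [← h2]
      refine Finset.card_le_card_of_injOn (fun σ => σ * τ⁻¹) ?_ ?_
      · intro σ hσ
        have hσ' : g ∘ σ = g ∘ τ := by simpa using hσ
        have : g ∘ ⇑(σ * τ⁻¹) = g := by
          funext i
          have := congrFun hσ' (τ⁻¹ i)
          simpa using this
        simpa using this
      · intro a _ b _ hab
        exact mul_right_cancel hab)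
  rw [Finset.card_univ, Fintype.card_perm, Fintype.card_fin] at h1
  refine h1.trans (Nat.mul_le_mul_left _ (Finset.card_le_card ?_))
  intro f hf
  obtain ⟨σ, -, rfl⟩ := Finset.mem_image.1 hf
  simp only [Finset.mem_filter_univ]
  intro j
  rw [← hk j]
  refine Finset.card_bij (fun i _ => σ i) ?_ ?_ ?_
  · simp
  · intro a _ b _ h
    exact σ.injective h
  · intro b hb
    exact ⟨σ.symm b, by simpa using hb, by simp⟩

theorem prod_comp_eq_pow {n m : ℕ} (f : Fin m → Fin n) (c : Fin n → ℝ) :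
    ∏ i, c (f i) = ∏ j, c j ^ ({i | f i = j} : Finset (Fin m)).card := by
  rw [← Finset.prod_fiberwise' Finset.univ f c]
  exact Finset.prod_congr rfl fun j _ => by rw [Finset.prod_const]

/-! ### Extracting the mixed term -/

section
variable {X : Type*} [NormedAddCommGroup X] [NormedSpace ℝ X]

theorem norm_diag_le_diagNorm {m : ℕ} (L : ContinuousMultilinearMap ℝ (fun _ : Fin m => X) ℝ)
    {y : X} (hy : ‖y‖ ≤ 1) : ‖L (fun _ => y)‖ ≤ diagNorm L := by
  refine le_ciSup (f := fun x : Metric.closedBall (0 : X) 1 => ‖L (fun _ => (x : X))‖)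
    ⟨‖L‖, ?_⟩ ⟨y, by simpa using hy⟩
  rintro _ ⟨x, rfl⟩
  refine (L.le_opNorm _).trans (mul_le_of_le_one_right (norm_nonneg _) ?_)
  exact Finset.prod_le_one (fun _ _ => norm_nonneg _) fun _ _ => mem_closedBall_zero_iff.1 x.2

theorem diagNorm_nonneg {m : ℕ} (L : ContinuousMultilinearMap ℝ (fun _ : Fin m => X) ℝ) :
    0 ≤ diagNorm L := Real.iSup_nonneg fun _ => norm_nonneg _

theorem map_diag_sum {n m : ℕ} (L : ContinuousMultilinearMap ℝ (fun _ : Fin m => X) ℝ)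
    (c : Fin n → ℝ) (x : Fin n → X) :
    L (fun _ => ∑ j, c j • x j) = ∑ f : Fin m → Fin n,
      (∏ j, c j ^ ({i | f i = j} : Finset (Fin m)).card) * L (x ∘ f) := by
  rw [L.map_sum (fun _ j => c j • x j)]
  refine Finset.sum_congr rfl fun f _ => ?_
  rw [L.map_smul_univ (fun i => c (f i)) (fun i => x (f i)), prod_comp_eq_pow, smul_eq_mul]
  rfl

theorem norm_map_comp_le {n m : ℕ} (L : ContinuousMultilinearMap ℝ (fun _ : Fin m => X) ℝ)
    (hL : IsSymmForm L) (g : Fin m → Fin n) (k : Fin n → ℕ)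
    (hk : ∀ j, ({i | g i = j} : Finset (Fin m)).card = k j)
    (x : Fin n → X) (hx : ∀ j, ‖x j‖ ≤ 1) (r : Fin n → ℝ) (hr0 : ∀ j, 0 ≤ r j)
    (hr : ∑ j, r j ≤ 1) :
    m.factorial * (∏ j, r j ^ k j) * ‖L (x ∘ g)‖ ≤
      2 ^ m * (∏ j, ((k j).factorial : ℝ)) * diagNorm L := by
  choose N t w ht hw hlt heq using fun j => exists_chebyshev_functional (k j)
  set S : Finset (Fin m → Fin n) := {f | ∀ j, ({i | f i = j} : Finset (Fin m)).card = k j}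
  have hkm : ∑ j, k j = m := by
    simp_rw [← hk]
    rw [← Finset.card_eq_sum_card_fiberwise (fun _ _ => Finset.mem_coe.2 (Finset.mem_univ _))]
    simp
  have hmom : ∀ f : Fin m → Fin n, ∏ j, ∑ s, w j s * t j s ^ ({i | f i = j} : Finset (Fin m)).card =
      if f ∈ S then (2⁻¹ : ℝ) ^ m else 0 := by
    intro f
    split_ifs with hf
    · have h1 : (2⁻¹ : ℝ) ^ m = ∏ j, 2⁻¹ ^ k j := by rw [Finset.prod_pow_eq_pow_sum, hkm]
      rw [h1]
      refine Finset.prod_congr rfl fun j _ => ?_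
      rw [(Finset.mem_filter_univ f).1 hf j, heq]
    -- Both families of multiplicities sum to `m`, so if they differ, one falls short.
    · have h1 : ∃ j, ({i | f i = j} : Finset (Fin m)).card < k j := by
        by_contra! hcon
        refine hf ((Finset.mem_filter_univ f).2 fun j => ?_)
        have h2 : ∑ j, k j = ∑ j, ({i | f i = j} : Finset (Fin m)).card := by
          rw [hkm, ← Finset.card_eq_sum_card_fiberwise
            (fun _ _ => Finset.mem_coe.2 (Finset.mem_univ _))]
          simp
        exact ((Finset.sum_eq_sum_iff_of_le fun j _ => hcon j).1 h2 j (Finset.mem_univ j)).symm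
      obtain ⟨j, hj⟩ := h1
      exact Finset.prod_eq_zero (Finset.mem_univ j) (hlt j _ hj)
  have hval : ∀ f ∈ S, (∏ j, r j ^ ({i | f i = j} : Finset (Fin m)).card) * L (x ∘ f) =
      (∏ j, r j ^ k j) * L (x ∘ g) := by
    intro f hf
    have hf' := (Finset.mem_filter_univ f).1 hf
    obtain ⟨σ, rfl⟩ := exists_perm_of_card_fiber (f := f) (g := g) fun j => by rw [hf', hk]
    congr 1
    · exact Finset.prod_congr rfl fun j _ => by rw [hf']
    · exact hL σ (x ∘ g)
  have havg : ∑ s : ∀ j, Fin (N j), (∏ j, w j (s j)) * L (fun _ => ∑ j, (r j * t j (s j)) • x j) =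
      S.card * ((2⁻¹ : ℝ) ^ m * ((∏ j, r j ^ k j) * L (x ∘ g))) := by
    have h1 : ∀ f : Fin m → Fin n, ∑ s : ∀ j, Fin (N j), (∏ j, w j (s j)) *
        ((∏ j, (r j * t j (s j)) ^ ({i | f i = j} : Finset (Fin m)).card) * L (x ∘ f)) =
        if f ∈ S then (2⁻¹ : ℝ) ^ m * ((∏ j, r j ^ k j) * L (x ∘ g)) else 0 := by
      intro f
      have h2 : ∑ s : ∀ j, Fin (N j), (∏ j, w j (s j)) *
        ((∏ j, (r j * t j (s j)) ^ ({i | f i = j} : Finset (Fin m)).card) * L (x ∘ f)) =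
        (∏ j, ∑ s, w j s * t j s ^ ({i | f i = j} : Finset (Fin m)).card) *
          ((∏ j, r j ^ ({i | f i = j} : Finset (Fin m)).card) * L (x ∘ f)) := by
        rw [Finset.prod_univ_sum, Fintype.piFinset_univ, Finset.sum_mul]
        refine Finset.sum_congr rfl fun s _ => ?_
        simp_rw [mul_pow]
        rw [Finset.prod_mul_distrib, Finset.prod_mul_distrib]
        ring
      rw [h2, hmom]
      split_ifs with hf
      · rw [hval f hf]
      · rw [zero_mul]
    simp_rw [map_diag_sum L, Finset.mul_sum]
    rw [Finset.sum_comm, Finset.sum_congr rfl fun f _ => h1 f, Finset.sum_ite_mem,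
      Finset.univ_inter, Finset.sum_const, nsmul_eq_mul]
  have hbound : |∑ s : ∀ j, Fin (N j), (∏ j, w j (s j)) *
      L (fun _ => ∑ j, (r j * t j (s j)) • x j)| ≤ diagNorm L := by
    calc _ ≤ ∑ s : ∀ j, Fin (N j), |(∏ j, w j (s j)) *
          L (fun _ => ∑ j, (r j * t j (s j)) • x j)| := Finset.abs_sum_le_sum_abs _ _
      _ ≤ ∑ s : ∀ j, Fin (N j), (∏ j, |w j (s j)|) * diagNorm L := by
        refine Finset.sum_le_sum fun s _ => ?_
        rw [abs_mul, Finset.abs_prod]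
        refine mul_le_mul_of_nonneg_left (norm_diag_le_diagNorm L ?_)
          (Finset.prod_nonneg fun _ _ => abs_nonneg _)
        refine (norm_sum_le _ _).trans ((Finset.sum_le_sum fun j _ => ?_).trans hr)
        rw [norm_smul, Real.norm_eq_abs, abs_mul, abs_of_nonneg (hr0 j)]
        calc r j * |t j (s j)| * ‖x j‖ ≤ r j * 1 * 1 := by
              gcongr
              exacts [mul_nonneg (hr0 j) zero_le_one, hr0 j, ht j _, hx j]
          _ = r j := by ring
      _ = (∏ j, ∑ s, |w j s|) * diagNorm L := by
        rw [Finset.prod_univ_sum, Fintype.piFinset_univ, Finset.sum_mul]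
      _ ≤ 1 * diagNorm L := by
        refine mul_le_mul_of_nonneg_right ?_ (diagNorm_nonneg L)
        exact Finset.prod_le_one (fun j _ => Finset.sum_nonneg fun _ _ => abs_nonneg _)
          fun j _ => hw j
      _ = _ := one_mul _
  have hR : 0 ≤ ∏ j, r j ^ k j := Finset.prod_nonneg fun j _ => pow_nonneg (hr0 j) _
  rw [havg, abs_mul, abs_mul, abs_mul, Nat.abs_cast, abs_of_nonneg hR,
    abs_of_nonneg (by positivity : (0 : ℝ) ≤ 2⁻¹ ^ m)] at hbound
  have hcard : (m.factorial : ℝ) ≤ (∏ j, ((k j).factorial : ℝ)) * S.card := by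
    exact_mod_cast factorial_le_card_fiber_mul g k hk
  calc m.factorial * (∏ j, r j ^ k j) * ‖L (x ∘ g)‖
      ≤ ((∏ j, ((k j).factorial : ℝ)) * S.card) * (∏ j, r j ^ k j) * ‖L (x ∘ g)‖ := by gcongr
    _ = 2 ^ m * (∏ j, ((k j).factorial : ℝ)) *
        (S.card * ((2⁻¹ : ℝ) ^ m * ((∏ j, r j ^ k j) * |L (x ∘ g)|))) := by
      have : (2 : ℝ) ^ m * 2⁻¹ ^ m = 1 := by rw [← mul_pow]; norm_num
      rw [Real.norm_eq_abs]
      linear_combination (-(∏ j, ((k j).factorial : ℝ)) * S.card * (∏ j, r j ^ k j) *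
        |L (x ∘ g)|) * this
    _ ≤ _ := by gcongr

theorem le_of_factorial_mul_prod_pow_mul_le {n m : ℕ} (k : Fin n → ℕ) (hkm : ∑ j, k j = m)
    (hm : 0 < m) {A D : ℝ} (hA : 0 ≤ A) (hD : 0 ≤ D)
    (h1 : m.factorial * (∏ j, ((k j : ℝ) / m) ^ k j) * A ≤
      2 ^ m * (∏ j, ((k j).factorial : ℝ)) * D) :
    A ≤ 2 ^ m * (Real.exp 1 * (m + 1)) ^ n * D := by
  have hm0 : (0 : ℝ) < m := by exact_mod_cast hm
  -- Empty blocks contribute `0 ^ 0 = 1`, so this factor can be cancelled at the end.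
  have hP : 0 < ∏ j, (k j : ℝ) ^ k j := Finset.prod_pos fun j _ => by
    rcases Nat.eq_zero_or_pos (k j) with h | h
    · simp [h]
    · positivity
  have h2 : ∏ j, ((k j : ℝ) / m) ^ k j = (∏ j, (k j : ℝ) ^ k j) / m ^ m := by
    simp_rw [div_pow]
    rw [Finset.prod_div_distrib, Finset.prod_pow_eq_pow_sum, hkm]
  have h3 : ∏ j, ((k j).factorial : ℝ) ≤
      (Real.exp 1 * (m + 1)) ^ n * (∏ j, (k j : ℝ) ^ k j) * Real.exp (-m) := by
    calc ∏ j, ((k j).factorial : ℝ)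
        ≤ ∏ j, (Real.exp 1 * (m + 1) * ((k j : ℝ) ^ k j * Real.exp (-(k j : ℝ)))) := by
          refine Finset.prod_le_prod (fun _ _ => by positivity) fun j _ =>
            (factorial_le_exp_mul_pow (k j)).trans ?_
          have : (k j : ℝ) ≤ m := by
            rw [← hkm]
            exact_mod_cast Finset.single_le_sum (fun i _ => Nat.zero_le (k i)) (Finset.mem_univ j)
          gcongr
      _ = _ := by
          rw [Finset.prod_mul_distrib, Finset.prod_const, Finset.card_univ,
            Fintype.card_fin, Finset.prod_mul_distrib, ← Real.exp_sum, Finset.sum_neg_distrib,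
            ← Nat.cast_sum, hkm, ← mul_assoc]
  have h4 : (m : ℝ) ^ m * Real.exp (-m) ≤ m.factorial := by
    have := Real.pow_div_factorial_le_exp (m : ℝ) hm0.le m
    rw [div_le_iff₀ (by positivity)] at this
    rw [Real.exp_neg, ← div_eq_mul_inv, div_le_iff₀ (Real.exp_pos _)]
    linarith
  rw [h2] at h1
  have h5 : Real.exp (-m) * (∏ j, (k j : ℝ) ^ k j) * A ≤ Real.exp (-m) * (∏ j, (k j : ℝ) ^ k j) *
      (2 ^ m * (Real.exp 1 * (m + 1)) ^ n * D) := by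
    calc Real.exp (-m) * (∏ j, (k j : ℝ) ^ k j) * A
        = ((m : ℝ) ^ m * Real.exp (-m)) * ((∏ j, (k j : ℝ) ^ k j) / m ^ m) * A := by field_simp
      _ ≤ m.factorial * ((∏ j, (k j : ℝ) ^ k j) / m ^ m) * A := by gcongr
      _ ≤ _ := h1
      _ ≤ 2 ^ m * ((Real.exp 1 * (m + 1)) ^ n * (∏ j, (k j : ℝ) ^ k j) * Real.exp (-m)) *
          D := by gcongr
      _ = _ := by ring
  exact le_of_mul_le_mul_left h5 (by positivity)

theorem blockNorm_le {n : ℕ} (k : Fin n → ℕ) (hm : 0 < ∑ i, k i)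
    (L : ContinuousMultilinearMap ℝ (fun _ : Fin (∑ i, k i) => X) ℝ) (hL : IsSymmForm L) :
    blockNorm k L ≤
      2 ^ (∑ i, k i) * (Real.exp 1 * (((∑ i, k i : ℕ) : ℝ) + 1)) ^ n * diagNorm L := by
  have : Nonempty (Fin n → Metric.closedBall (0 : X) 1) := ⟨fun _ => ⟨0, by simp⟩⟩
  refine ciSup_le fun x => ?_
  have hcard : ∀ j, ({i | (finSigmaFinEquiv.symm i).1 = j} : Finset (Fin (∑ i, k i))).card = k j := by
    intro j
    rw [← Fintype.card_subtype, ← Fintype.card_fin (k j)]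
    exact Fintype.card_congr ((finSigmaFinEquiv.symm.subtypeEquiv fun _ => Iff.rfl).trans
      (Equiv.sigmaSubtype j))
  refine le_of_factorial_mul_prod_pow_mul_le k rfl hm (norm_nonneg _) (diagNorm_nonneg L) ?_
  refine norm_map_comp_le L hL (fun i => (finSigmaFinEquiv.symm i).1) k hcard
    (fun i => (x i : X)) (fun i => mem_closedBall_zero_iff.1 (x i).2)
    -- These weights maximize `∏ j, r j ^ k j` on the simplex.
    (fun j => k j / (∑ i, k i : ℕ)) (fun j => by positivity) ?_
  rw [← Finset.sum_div, ← Nat.cast_sum, div_self (by exact_mod_cast hm.ne')]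

theorem polarizationConst_le {n : ℕ} (k : Fin n → ℕ) (hm : 0 < ∑ i, k i) :
    polarizationConst ℝ k X ≤ ENNReal.ofReal
      (2 ^ (∑ i, k i) * (Real.exp 1 * (((∑ i, k i : ℕ) : ℝ) + 1)) ^ n) :=
  iInf₂_le _ ⟨by positivity, fun L hL => blockNorm_le k hm L hL⟩

end

end PolarizationConstant

theorem corollary4p2 (n : ℕ) (X : Type*) [NormedAddCommGroup X] [NormedSpace ℝ X]
    [CompleteSpace X] :
    limsup (fun m : ℕ => ⨆ (k : Fin n → ℕ) (_ : ∑ i, k i = m),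
      PolarizationConstant.polarizationConst ℝ k X ^ (1 / (m : ℝ))) atTop ≤ 2 := by
  rw [← (PolarizationConstant.tendsto_two_pow_mul_rpow_one_div n).limsup_eq]
  refine limsup_le_limsup ?_
  filter_upwards [eventually_gt_atTop 0] with m hm
  refine iSup₂_le fun k hk => ?_
  subst hk
  exact ENNReal.rpow_le_rpow (PolarizationConstant.polarizationConst_le k hm) (by positivity)
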